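/- Let $\Omega\subset\mathbb{R}^N$ be a bounded open set, $T>0$, $0<c<1$, $0<\varepsilon\le\eta$. Put $\Omega_T=\Omega\times(0,T]$ and, for $\rho>0$, $$\Gamma_\rho=\{x:\operatorname{dist}(x,\Omega)\le\rho\}\times(-\rho^2,0]\ \cup\ \{x\notin\Omega:\operatorname{dist}(x,\partial\Omega)\le\rho\}\times(0,T].$$ For every $(x,t)\in\Omega_T$ let $\mathcal{A}(x,t)$ be a compact subset of $B(0,1)\times[-\tfrac c2,\tfrac c2]$ (with $B(0,1)\subset\mathbb{R}^N$ the open unit ball) containing $(0,0)$, and put $$\mathcal{A}_\varepsilon(x,t)=\Big\{(x,t)+\Big(\varepsilon y,\ \varepsilon^2\tfrac{1-c}{c}s-\varepsilon^2\tfrac{c+1}{2}\Big):(y,s)\in\mathcal{A}(x,t)\Big\}\subset\Omega_T\cup\Gamma_\varepsilon.$$ Let $F:\Gamma_\eta\to\mathbb{R}$ be a bounded Borel function. A function $u:\Omega_T\cup\Gamma_\varepsilon\to\mathbb{R}$ verifies the Dynamic Programming Principle (DPP) with boundary values $F$ if $u=F$ on $\Gamma_\varepsilon$ and, for every $(x,t)\in\Omega_T$,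 $$u(x,t)=\tfrac12\sup_{\mathcal{A}_\varepsilon(x,t)}u+\tfrac12\inf_{\mathcal{A}_\varepsilon(x,t)}u$$ (with finite supremum and infimum). The game: a token starts at $p_0\in\Omega_T\cup\Gamma_\varepsilon$. As long as the current state $p_k$ is in $\Omega_T$, a fair coin (independent of the past) is tossed and the winner of the toss moves the token to a state $p_{k+1}\in\mathcal{A}_\varepsilon(p_k)$, prescribed by the winner's strategy; the game ends at the first round $\tau$ with $p_\tau\in\Gamma_\varepsilon$ (which occurs after finitely many rounds), and Player II pays $F(p_\tau)$ to Player I. A strategy is a map that assigns to every partial history $(p_0,\dots,p_k)$ with $p_k\in\Omega_T$ a state in $\mathcal{A}_\varepsilon(p_k)$ (every such map is allowed, i.e. histories carry the discrete $\sigma$-algebra). Let $$u_I^\varepsilon(p)=\sup_{S_I}\inf_{S_{II}}\mathbb{E}^{p}_{S_I,S_{II}}[F(p_\tau)],\qquad u_{II}^\varepsilon(p)=\inf_{S_{II}}\sup_{S_I}\mathbb{E}^{p}_{S_I,S_{II}}[F(p_\tau)].$$ Then there exists a unique function $u_\varepsilon:\Omega_T\cup\Gamma_\varepsilon\to\mathbb{R}$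 that verifies the DPP with boundary values $F$. Moreover $u_\varepsilon$ coincides with the $\varepsilon$-value of the game: $u_\varepsilon=u_I^\varepsilon=u_{II}^\varepsilon$ on $\Omega_T\cup\Gamma_\varepsilon$. -/

import Mathlib

open MeasureTheory Set

namespace TugOfWar

/-- Space-time `ℝ^N × ℝ`; a game state is a pair `(x, t)`. -/
abbrev State (N : ℕ) : Type := EuclideanSpace ℝ (Fin N) × ℝ

/-- The parabolic cylinder `Ω_T = Ω × (0, T]`. -/
def cylinder {N : ℕ} (Ω : Set (EuclideanSpace ℝ (Fin N))) (T : ℝ) : Set (State N) :=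
  Ω ×ˢ Ioc 0 T

/-- The strip `Γ_η = Ω_η × (-η², 0] ∪ Θ_η × (0, T]` around the parabolic boundary, where
`Ω_η = {x : dist(x, Ω) ≤ η}` and `Θ_η = {x ∉ Ω : dist(x, ∂Ω) ≤ η}`. -/
def strip {N : ℕ} (Ω : Set (EuclideanSpace ℝ (Fin N))) (T η : ℝ) : Set (State N) :=
  Metric.cthickening η Ω ×ˢ Ioc (-η ^ 2) 0 ∪
    (Ωᶜ ∩ Metric.cthickening η (frontier Ω)) ×ˢ Ioc 0 T

/-- For every `(x, t) ∈ Ω_T`, the set `𝒜(x, t)` is a compact subset of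
`B(0, 1) × [-c/2, c/2]` which contains `(0, 0)`. -/
def Admissible {N : ℕ} (Ω : Set (EuclideanSpace ℝ (Fin N))) (T c : ℝ)
    (A : State N → Set (State N)) : Prop :=
  ∀ p ∈ cylinder Ω T,
    IsCompact (A p) ∧ A p ⊆ Metric.ball 0 1 ×ˢ Icc (-(c / 2)) (c / 2) ∧ (0, 0) ∈ A p

/-- The set of possible movements
`𝒜_ε(x, t) = {(x, t) + (ε y, ε² (1 - c) / c * s - ε² (c + 1) / 2) : (y, s) ∈ 𝒜(x, t)}`. -/
def moves {N : ℕ} (c ε : ℝ) (A : State N → Set (State N)) (p : State N) : Set (State N) :=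
  (fun q : State N =>
    p + (ε • q.1, ε ^ 2 * ((1 - c) / c) * q.2 - ε ^ 2 * ((c + 1) / 2))) '' A p

/-- `u` verifies the dynamic programming principle in `Ω_T`, with boundary values `F`:
`u(p) = ½ sup_{𝒜_ε(p)} u + ½ inf_{𝒜_ε(p)} u` on `Ω_T` (supremum and infimum being finite),
and `u = F` on `Γ_ε`. -/
def SatisfiesDPP {N : ℕ} (Ω : Set (EuclideanSpace ℝ (Fin N))) (T c ε : ℝ)
    (A : State N → Set (State N)) (F u : State N → ℝ) : Prop :=
  (∀ p ∈ cylinder Ω T, ∃ a b : ℝ,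
    IsLUB (u '' moves c ε A p) a ∧ IsGLB (u '' moves c ε A p) b ∧ u p = a / 2 + b / 2) ∧
  ∀ p ∈ strip Ω T ε, u p = F p

/-- A strategy: a map which chooses, for every partial history `(p_0, …, p_k)` whose current state `p_k` lies in
`Ω_T`, a next state in `𝒜_ε(p_k)`. As the randomness consists of finitely many coin tosses, no Borel
regularity is needed (every map is measurable for the discrete `σ`-algebra on histories). -/
structure Strategy {N : ℕ} (Ω : Set (EuclideanSpace ℝ (Fin N))) (T c ε : ℝ)
    (A : State N → Set (State N)) where
  next : (k : ℕ) → (Fin (k + 1) → State N) → State N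
  legal : ∀ (k : ℕ) (h : Fin (k + 1) → State N),
    h (Fin.last k) ∈ cylinder Ω T → next k h ∈ moves c ε A (h (Fin.last k))

/-- The law of an infinite sequence of independent tosses of a fair coin. -/
noncomputable def coinLaw : Measure (ℕ → Bool) :=
  Measure.infinitePi fun _ : ℕ => (PMF.uniformOfFintype Bool).toMeasure

open Classical in
/-- The history `(p_0, …, p_k)` after `k` rounds, when Player I uses `SI`, Player II uses `SII`
and the coin tosses are `ω`. Player I wins the toss of round `k + 1` if `ω k` is `true`.
The token no longer moves once it has reached `Γ_ε`. -/
noncomputable def history {N : ℕ} {Ω : Set (EuclideanSpace ℝ (Fin N))} {T c ε : ℝ}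
    {A : State N → Set (State N)} (SI SII : Strategy Ω T c ε A) (p : State N)
    (ω : ℕ → Bool) : (k : ℕ) → (Fin (k + 1) → State N)
  | 0 => fun _ => p
  | k + 1 =>
    let h := history SI SII p ω k
    Fin.snoc (α := fun _ => State N) h
      (if h (Fin.last k) ∈ strip Ω T ε then h (Fin.last k)
        else if ω k = true then SI.next k h else SII.next k h)

/-- The state of the game after `k` rounds. -/
noncomputable def position {N : ℕ} {Ω : Set (EuclideanSpace ℝ (Fin N))} {T c ε : ℝ}
    {A : State N → Set (State N)} (SI SII : Strategy Ω T c ε A) (p : State N)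
    (ω : ℕ → Bool) (k : ℕ) : State N :=
  history SI SII p ω k (Fin.last k)

/-- The number of rounds until the token hits `Γ_ε` (finite, since each round takes at least
`c ε²` off the time). -/
noncomputable def hittingRound {N : ℕ} {Ω : Set (EuclideanSpace ℝ (Fin N))} {T c ε : ℝ}
    {A : State N → Set (State N)} (SI SII : Strategy Ω T c ε A) (p : State N)
    (ω : ℕ → Bool) : ℕ :=
  sInf {k : ℕ | position SI SII p ω k ∈ strip Ω T ε}

/-- The expected payoff `𝔼[F(x_τ, t_τ)]` of the game started at `p`. -/
noncomputable def expectedPayoff {N : ℕ} {Ω : Set (EuclideanSpace ℝ (Fin N))} {T c ε : ℝ}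
    {A : State N → Set (State N)} (F : State N → ℝ) (SI SII : Strategy Ω T c ε A)
    (p : State N) : ℝ :=
  ∫ ω, F (position SI SII p ω (hittingRound SI SII p ω)) ∂coinLaw

/-- The `ε`-value of the game for Player I. -/
noncomputable def valueI {N : ℕ} (Ω : Set (EuclideanSpace ℝ (Fin N))) (T c ε : ℝ)
    (A : State N → Set (State N)) (F : State N → ℝ) (p : State N) : ℝ :=
  ⨆ SI : Strategy Ω T c ε A, ⨅ SII : Strategy Ω T c ε A, expectedPayoff F SI SII p

/-- The `ε`-value of the game for Player II. -/
noncomputable def valueII {N : ℕ} (Ω : Set (EuclideanSpace ℝ (Fin N))) (T c ε : ℝ)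
    (A : State N → Set (State N)) (F : State N → ℝ) (p : State N) : ℝ :=
  ⨅ SII : Strategy Ω T c ε A, ⨆ SI : Strategy Ω T c ε A, expectedPayoff F SI SII p

end TugOfWar

/-! Every move lowers the time by at least `c * ε ^ 2` (`snd_le_of_mem_moves`), so the DPP is an
explicit recursion in time and every play ends within `K ≥ T / (c * ε ^ 2)` rounds. Uniqueness is
induction over time slabs; existence holds because the iterates of `dppOperator` become stationary
after finitely many steps, with no limit to take.

For the value, let one player always choose a move where `u` is within `d` of its supremum (or
infimum). Against any opponent, `u` along the play is then a sub- (or super-) martingale up to an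
error `d` per round (`integral_comp_position_le`). At round `K` the token lies in the strip, where
`u = F`, so the total error is at most `K * d`, which is arbitrarily small
(`exists_strategies_near_optimal`). -/

namespace TugOfWar

/-! ### Fair coin tosses. -/

section Coins

/-- The sequence of tosses in which the outcome of toss `k` is reversed. -/
def flipToss (k : ℕ) (ω : ℕ → Bool) (i : ℕ) : Bool :=
  if i = k then !(ω i) else ω i

lemma flipToss_self (k : ℕ) (ω : ℕ → Bool) : flipToss k ω k = !(ω k) := by
  simp [flipToss]

lemma flipToss_of_ne {k i : ℕ} (h : i ≠ k) (ω : ℕ → Bool) : flipToss k ω i = ω i := by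
  simp [flipToss, h]

instance : IsProbabilityMeasure coinLaw := by
  unfold coinLaw; infer_instance

lemma map_not_fairCoin :
    (PMF.uniformOfFintype Bool).toMeasure.map (fun b => !b) =
      (PMF.uniformOfFintype Bool).toMeasure := by
  rw [PMF.toMeasure_map _ _ (measurable_of_finite _)]
  congr 1
  ext b
  cases b <;> simp [PMF.map_apply]

/-- Pairing `ω` with `flipToss k ω` replaces conditioning on the first `k` tosses. -/
lemma measurePreserving_flipToss (k : ℕ) :
    MeasurePreserving (flipToss k) coinLaw coinLaw := by
  have hm : ∀ i : ℕ, Measurable fun b : Bool => if i = k then !b else b :=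
    fun i => measurable_of_finite _
  have h := Measure.infinitePi_map_pi
    (fun _ : ℕ => (PMF.uniformOfFintype Bool).toMeasure) hm
  refine ⟨measurable_pi_lambda _ fun i => (hm i).comp (measurable_pi_apply i), ?_⟩
  refine h.trans ?_
  unfold coinLaw
  congr 1
  funext i
  by_cases hi : i = k
  · simpa [hi] using map_not_fairCoin
  · simp [hi]

/-- Such an `f` factors through a finite discrete space, so strategies and payoffs need no
regularity. -/
lemma measurable_of_dependsOn_Iio {f : (ℕ → Bool) → ℝ} {k : ℕ}
    (hf : DependsOn f (Iio k)) : Measurable f := by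
  obtain ⟨g, rfl⟩ := dependsOn_iff_exists_comp.1 hf
  exact (measurable_of_finite g).comp (by fun_prop)

lemma integrable_of_dependsOn_Iio {f : (ℕ → Bool) → ℝ} {k : ℕ}
    (hf : DependsOn f (Iio k)) : Integrable f coinLaw := by
  obtain ⟨g, hg⟩ := dependsOn_iff_exists_comp.1 hf
  obtain ⟨C, hC⟩ := (Set.finite_range fun x => ‖g x‖).bddAbove
  refine Integrable.of_bound (measurable_of_dependsOn_Iio hf).aestronglyMeasurable C
    (Filter.Eventually.of_forall fun ω => ?_)
  rw [hg]
  exact hC ⟨_, rfl⟩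

/-- If the average of `g` over the two outcomes of toss `k` exceeds `f` by at most `δ`, then so
does its expectation. -/
lemma integral_le_of_flipToss {f g : (ℕ → Bool) → ℝ} {k : ℕ} {δ : ℝ}
    (hf : Integrable f coinLaw) (hg : Integrable g coinLaw)
    (h : ∀ ω, g ω + g (flipToss k ω) ≤ 2 * (f ω + δ)) :
    ∫ ω, g ω ∂coinLaw ≤ ∫ ω, f ω ∂coinLaw + δ := by
  have hp := measurePreserving_flipToss k
  have hflip : ∫ ω, g (flipToss k ω) ∂coinLaw = ∫ ω, g ω ∂coinLaw := by
    have h1 := integral_map (μ := coinLaw) hp.measurable.aemeasurable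
      (f := g) (by rw [hp.map_eq]; exact hg.aestronglyMeasurable)
    rw [hp.map_eq] at h1
    exact h1.symm
  have hg' : Integrable (fun ω => g (flipToss k ω)) coinLaw := hp.integrable_comp_of_integrable hg
  have hmono : ∫ ω, (g ω + g (flipToss k ω)) ∂coinLaw ≤ ∫ ω, 2 * (f ω + δ) ∂coinLaw :=
    integral_mono (hg.add hg') ((hf.add (integrable_const δ)).const_mul 2) h
  rw [integral_add hg hg', hflip, integral_const_mul, integral_add hf (integrable_const δ)] at hmono
  simp only [integral_const, probReal_univ, smul_eq_mul, one_mul] at hmono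
  linarith

end Coins

/-! ### Geometry of a single move. -/

section Moves

variable {N : ℕ} {Ω : Set (EuclideanSpace ℝ (Fin N))} {T c ε : ℝ}
  {A : State N → Set (State N)}

/-- Otherwise the interior and the exterior of `s` would disconnect the segment. -/
lemma exists_mem_segment_frontier {E : Type*} [NormedAddCommGroup E] [NormedSpace ℝ E]
    {s : Set E} {x y : E} (hx : x ∈ s) (hy : y ∉ s) : ∃ z ∈ segment ℝ x y, z ∈ frontier s := by
  by_contra! h
  have hpre : IsPreconnected (segment ℝ x y) := (convex_segment x y).isPreconnected
  have hcover : segment ℝ x y ⊆ interior s ∪ (closure s)ᶜ := by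
    intro z hz
    by_cases h1 : z ∈ interior s
    · exact Or.inl h1
    · exact Or.inr fun h2 => h z hz ⟨h2, h1⟩
  obtain ⟨z, -, hz1, hz2⟩ := hpre _ _ isOpen_interior isClosed_closure.isOpen_compl hcover
    ⟨x, left_mem_segment ℝ x y, (hcover (left_mem_segment ℝ x y)).resolve_right
      fun h' => h' (subset_closure hx)⟩
    ⟨y, right_mem_segment ℝ x y, (hcover (right_mem_segment ℝ x y)).resolve_left
      fun h' => hy (interior_subset h')⟩
  exact hz2 (subset_closure (interior_subset hz1))

lemma disjoint_cylinder_strip {p : State N} (hp : p ∈ cylinder Ω T) : p ∉ strip Ω T ε := by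
  rintro (h | h)
  · exact absurd hp.2.1 (not_lt.2 h.2.2)
  · exact h.1.1 hp.1

lemma strip_subset_strip {η : ℝ} (hε : 0 < ε) (hεη : ε ≤ η) :
    strip Ω T ε ⊆ strip (N := N) Ω T η := by
  have hsq : ε ^ 2 ≤ η ^ 2 := by gcongr
  rintro p (h | h)
  · exact Or.inl ⟨Metric.cthickening_mono hεη _ h.1, by linarith [h.2.1], h.2.2⟩
  · exact Or.inr ⟨⟨h.1.1, Metric.cthickening_mono hεη _ h.1.2⟩, h.2⟩

lemma moves_nonempty (hA : Admissible Ω T c A) {p : State N} (hp : p ∈ cylinder Ω T) :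
    (moves c ε A p).Nonempty :=
  ⟨_, _, (hA p hp).2.2, rfl⟩

/-- Each round takes at least `c ε²` off the time. -/
lemma snd_le_of_mem_moves (hc0 : 0 < c) (hc1 : c < 1) (hA : Admissible Ω T c A)
    {p q : State N} (hp : p ∈ cylinder Ω T) (hq : q ∈ moves c ε A p) :
    q.2 ≤ p.2 - c * ε ^ 2 := by
  obtain ⟨a, ha, rfl⟩ := hq
  obtain ⟨-, -, hs⟩ := (hA p hp).2.1 ha
  have h1 : (1 - c) / c * a.2 ≤ (1 - c) / c * (c / 2) :=
    mul_le_mul_of_nonneg_left hs (div_nonneg (by linarith) hc0.le)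
  -- At the extreme `s = c / 2` the time increment is `ε ^ 2 * ((1 - c) / 2 - (c + 1) / 2) = -c * ε
  -- ^ 2`.
  have h2 : (1 - c) / c * (c / 2) = (1 - c) / 2 := by field_simp
  have h3 := mul_le_mul_of_nonneg_left (h1.trans_eq h2) (sq_nonneg ε)
  simp only [Prod.snd_add]
  linarith

/-- Each round takes at most `ε²` off the time. -/
lemma le_snd_of_mem_moves (hc0 : 0 < c) (hc1 : c < 1) (hA : Admissible Ω T c A)
    {p q : State N} (hp : p ∈ cylinder Ω T) (hq : q ∈ moves c ε A p) :
    p.2 - ε ^ 2 ≤ q.2 := by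
  obtain ⟨a, ha, rfl⟩ := hq
  obtain ⟨-, hs, -⟩ := (hA p hp).2.1 ha
  have h1 : (1 - c) / c * (-(c / 2)) ≤ (1 - c) / c * a.2 :=
    mul_le_mul_of_nonneg_left hs (div_nonneg (by linarith) hc0.le)
  have h2 : (1 - c) / c * (-(c / 2)) = -((1 - c) / 2) := by field_simp
  have h3 := mul_le_mul_of_nonneg_left (h2.symm.trans_le h1) (sq_nonneg ε)
  simp only [Prod.snd_add]
  linarith

lemma dist_fst_le_of_mem_moves (hε : 0 < ε) (hA : Admissible Ω T c A)
    {p q : State N} (hp : p ∈ cylinder Ω T) (hq : q ∈ moves c ε A p) :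
    dist q.1 p.1 ≤ ε := by
  obtain ⟨a, ha, rfl⟩ := hq
  have hy := ((hA p hp).2.1 ha).1
  rw [mem_ball_zero_iff] at hy
  simp only [Prod.fst_add, dist_self_add_left, norm_smul, Real.norm_of_nonneg hε.le]
  nlinarith

/-- A move that leaves `Ω` at positive time crosses the frontier on a segment of length at most `ε`;
one that reaches time `≤ 0` stays above `-ε ^ 2`. -/
lemma moves_subset (hε : 0 < ε) (hc0 : 0 < c) (hc1 : c < 1) (hA : Admissible Ω T c A)
    {p : State N} (hp : p ∈ cylinder Ω T) :
    moves c ε A p ⊆ cylinder Ω T ∪ strip Ω T ε := by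
  intro q hq
  have h1 := snd_le_of_mem_moves hc0 hc1 hA hp hq
  have h2 := le_snd_of_mem_moves hc0 hc1 hA hp hq
  have h3 := dist_fst_le_of_mem_moves hε hA hp hq
  have h4 : 0 < c * ε ^ 2 := by positivity
  have hp1 : 0 < p.2 := hp.2.1
  have hp2 : p.2 ≤ T := hp.2.2
  rcases le_or_gt q.2 0 with h0 | h0
  · exact Or.inr (Or.inl ⟨Metric.mem_cthickening_of_dist_le _ p.1 _ _ hp.1 h3,
      by linarith, h0⟩)
  · have ht : q.2 ∈ Ioc 0 T := ⟨h0, by linarith⟩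
    by_cases hx : q.1 ∈ Ω
    · exact Or.inl ⟨hx, ht⟩
    · obtain ⟨z, hz, hzf⟩ := exists_mem_segment_frontier hp.1 hx
      refine Or.inr (Or.inr ⟨⟨hx, Metric.mem_cthickening_of_dist_le _ z _ _ hzf ?_⟩, ht⟩)
      have := dist_add_dist_of_mem_segment hz
      rw [dist_comm q.1 z]
      rw [dist_comm q.1 p.1] at h3
      linarith [dist_nonneg (x := p.1) (y := z)]

end Moves

/-! ### Existence and uniqueness for the DPP. -/

section DPP

variable {N : ℕ} {Ω : Set (EuclideanSpace ℝ (Fin N))} {T c ε : ℝ}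
  {A : State N → Set (State N)} {F : State N → ℝ}

/-- Two solutions of the dynamic programming principle agree. -/
lemma SatisfiesDPP.eqOn (hε : 0 < ε) (hc0 : 0 < c) (hc1 : c < 1) (hA : Admissible Ω T c A)
    {u v : State N → ℝ} (hu : SatisfiesDPP Ω T c ε A F u) (hv : SatisfiesDPP Ω T c ε A F v) :
    EqOn v u (cylinder Ω T ∪ strip Ω T ε) := by
  have hcε : 0 < c * ε ^ 2 := by positivity
  have key : ∀ n : ℕ, ∀ p ∈ cylinder Ω T ∪ strip Ω T ε, p.2 ≤ n * (c * ε ^ 2) → v p = u p := by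
    intro n
    induction n with
    | zero =>
      rintro p (hp | hp) ht
      · exact absurd hp.2.1 (not_lt.2 (by simpa using ht))
      · rw [hu.2 p hp, hv.2 p hp]
    | succ n ih =>
      rintro p (hp | hp) ht
      · obtain ⟨a, b, ha, hb, hab⟩ := hu.1 p hp
        obtain ⟨a', b', ha', hb', hab'⟩ := hv.1 p hp
        have him : v '' moves c ε A p = u '' moves c ε A p := by
          refine image_congr fun q hq => ih q (moves_subset hε hc0 hc1 hA hp hq) ?_
          have := snd_le_of_mem_moves hc0 hc1 hA hp hq
          push_cast at ht
          linarith
        rw [him] at ha' hb'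
        rw [hab, hab', ha.unique ha', hb.unique hb']
      · rw [hu.2 p hp, hv.2 p hp]
  intro p hp
  obtain ⟨n, hn⟩ := exists_nat_ge (p.2 / (c * ε ^ 2))
  exact key n p hp ((div_le_iff₀ hcε).1 hn)

open Classical in
/-- The operator whose fixed points solve the dynamic programming principle. -/
noncomputable def dppOperator (Ω : Set (EuclideanSpace ℝ (Fin N))) (T c ε : ℝ)
    (A : State N → Set (State N)) (F u : State N → ℝ) (p : State N) : ℝ :=
  if p ∈ cylinder Ω T then sSup (u '' moves c ε A p) / 2 + sInf (u '' moves c ε A p) / 2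
  -- The default 0 keeps the bound `M` valid on the whole space.
  else if p ∈ strip Ω T ε then F p else 0

lemma abs_dppOperator_le (hA : Admissible Ω T c A) {M : ℝ} (hM : 0 ≤ M)
    (hF : ∀ p ∈ strip Ω T ε, |F p| ≤ M) {u : State N → ℝ} (hu : ∀ p, |u p| ≤ M) (p : State N) :
    |dppOperator Ω T c ε A F u p| ≤ M := by
  unfold dppOperator
  split_ifs with h1 h2
  · have hne : (u '' moves c ε A p).Nonempty := (moves_nonempty hA h1).image u
    obtain ⟨x, hx⟩ := hne
    have hub : M ∈ upperBounds (u '' moves c ε A p) := by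
      rintro _ ⟨q, -, rfl⟩; exact (abs_le.1 (hu q)).2
    have hlb : -M ∈ lowerBounds (u '' moves c ε A p) := by
      rintro _ ⟨q, -, rfl⟩; exact (abs_le.1 (hu q)).1
    have h3 := csSup_le ⟨x, hx⟩ hub
    have h4 := le_csSup ⟨M, hub⟩ hx
    have h5 := le_csInf ⟨x, hx⟩ hlb
    have h6 := csInf_le ⟨-M, hlb⟩ hx
    have h7 := hub hx
    have h8 := hlb hx
    rw [abs_le]
    constructor <;> linarith
  · exact hF p h2
  · simpa using hM

/-- The dynamic programming principle has a bounded solution. -/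
lemma exists_satisfiesDPP (hε : 0 < ε) (hc0 : 0 < c) (hc1 : c < 1) (hA : Admissible Ω T c A)
    {M : ℝ} (hM : 0 ≤ M) (hF : ∀ p ∈ strip Ω T ε, |F p| ≤ M) :
    ∃ u : State N → ℝ, SatisfiesDPP Ω T c ε A F u ∧ ∀ p, |u p| ≤ M := by
  have hcε : 0 < c * ε ^ 2 := by positivity
  set D := dppOperator Ω T c ε A F with hD
  -- The exponent is `n + 1` so that `w 0` already has the boundary values and agrees with `w 1` at
  -- times `≤ 0`.
  set w : ℕ → State N → ℝ := fun n => D^[n + 1] 0 with hw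
  have hsucc : ∀ n, w (n + 1) = D (w n) := fun n => Function.iterate_succ_apply' D (n + 1) 0
  have hbd : ∀ n p, |w n p| ≤ M := by
    intro n
    induction n with
    | zero => exact abs_dppOperator_le hA hM hF fun p => by simpa using hM
    | succ n ih => rw [hsucc]; exact abs_dppOperator_le hA hM hF ih
  have hout : ∀ (u v : State N → ℝ) (p : State N), p ∉ cylinder Ω T → D u p = D v p := by
    intro u v p hp
    simp [hD, dppOperator, hp]
  have hstable : ∀ n : ℕ, ∀ p : State N, p.2 ≤ n * (c * ε ^ 2) → w (n + 1) p = w n p := by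
    intro n
    induction n with
    | zero =>
      intro p ht
      exact hout _ _ p fun hp => absurd hp.2.1 (not_lt.2 (by simpa using ht))
    | succ n ih =>
      intro p ht
      rw [hsucc (n + 1)]
      conv_rhs => rw [hsucc n]
      by_cases hp : p ∈ cylinder Ω T
      · have him : w (n + 1) '' moves c ε A p = w n '' moves c ε A p := by
          refine image_congr fun q hq => ih q ?_
          have := snd_le_of_mem_moves hc0 hc1 hA hp hq
          push_cast at ht
          linarith
        have hin : ∀ v, D v p = sSup (v '' moves c ε A p) / 2 + sInf (v '' moves c ε A p) / 2 :=
          fun v => if_pos hp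
        rw [hin, hin, him]
      · exact hout _ _ p hp
  obtain ⟨K, hK⟩ := exists_nat_ge (T / (c * ε ^ 2))
  rw [div_le_iff₀ hcε] at hK
  have hfix : D (w K) = w K := by
    funext p
    by_cases hp : p ∈ cylinder Ω T
    · rw [← hsucc]
      exact hstable K p (hp.2.2.trans hK)
    -- Here the time of `p` may exceed `T`, but off the cylinder `D` ignores its argument.
    · have h : w K = D (D^[K] 0) := Function.iterate_succ_apply' D K 0
      conv_rhs => rw [h]
      exact hout _ _ p hp
  refine ⟨w K, ⟨fun p hp => ?_, fun p hp => ?_⟩, hbd K⟩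
  · have hne : (w K '' moves c ε A p).Nonempty := (moves_nonempty hA hp).image _
    refine ⟨_, _, isLUB_csSup hne ⟨M, ?_⟩, isGLB_csInf hne ⟨-M, ?_⟩, ?_⟩
    · rintro _ ⟨q, -, rfl⟩; exact (abs_le.1 (hbd K q)).2
    · rintro _ ⟨q, -, rfl⟩; exact (abs_le.1 (hbd K q)).1
    · conv_lhs => rw [← hfix]
      simp [hD, dppOperator, hp]
  · have hp' : p ∉ cylinder Ω T := fun h => disjoint_cylinder_strip h hp
    rw [← hfix]
    simp [hD, dppOperator, hp', hp]

end DPP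

/-! ### Plays and near-optimal strategies. -/

section Game

variable {N : ℕ} {Ω : Set (EuclideanSpace ℝ (Fin N))} {T c ε : ℝ}
  {A : State N → Set (State N)} {F : State N → ℝ}

lemma history_dependsOn (SI SII : Strategy Ω T c ε A) (p : State N) (k : ℕ) :
    DependsOn (fun ω => history SI SII p ω k) (Iio k) := by
  induction k with
  | zero => intro ω ω' _; rfl
  | succ k ih =>
    intro ω ω' h
    have h1 : history SI SII p ω k = history SI SII p ω' k :=
      ih fun i hi => h i (Nat.lt_succ_of_lt hi)
    have h2 : ω k = ω' k := h k (Nat.lt_succ_self k)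
    simp only [history]
    rw [h1, h2]

lemma integrable_comp_position (f : State N → ℝ) (SI SII : Strategy Ω T c ε A) (p : State N)
    (k : ℕ) : Integrable (fun ω => f (position SI SII p ω k)) coinLaw :=
  integrable_of_dependsOn_Iio (k := k) fun _ _ h =>
    congrArg (fun g => f (g (Fin.last k))) (history_dependsOn SI SII p k h)

lemma history_flipToss (SI SII : Strategy Ω T c ε A) (p : State N) (ω : ℕ → Bool) (k : ℕ) :
    history SI SII p (flipToss k ω) k = history SI SII p ω k :=
  history_dependsOn SI SII p k fun _ hi => flipToss_of_ne (ne_of_lt hi) ω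

lemma position_succ_of_mem (SI SII : Strategy Ω T c ε A) {p : State N} {ω : ℕ → Bool} {k : ℕ}
    (h : position SI SII p ω k ∈ strip Ω T ε) :
    position SI SII p ω (k + 1) = position SI SII p ω k := by
  simp only [position, history, Fin.snoc_last]
  exact if_pos h

lemma position_succ_of_notMem (SI SII : Strategy Ω T c ε A) {p : State N} {ω : ℕ → Bool} {k : ℕ}
    (h : position SI SII p ω k ∉ strip Ω T ε) :
    position SI SII p ω (k + 1) =
      if ω k = true then SI.next k (history SI SII p ω k)
      else SII.next k (history SI SII p ω k) := by
  simp only [position, history, Fin.snoc_last]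
  exact if_neg h

lemma position_mem (hε : 0 < ε) (hc0 : 0 < c) (hc1 : c < 1) (hA : Admissible Ω T c A)
    (SI SII : Strategy Ω T c ε A) {p : State N} (hp : p ∈ cylinder Ω T ∪ strip Ω T ε)
    (ω : ℕ → Bool) (k : ℕ) :
    position SI SII p ω k ∈ strip Ω T ε ∨
      (position SI SII p ω k ∈ cylinder Ω T ∧
        (position SI SII p ω k).2 ≤ T - k * (c * ε ^ 2)) := by
  induction k with
  | zero =>
    rcases hp with hp | hp
    · exact Or.inr ⟨hp, by simpa [position, history] using hp.2.2⟩
    · exact Or.inl hp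
  | succ k ih =>
    rcases ih with h | ⟨h, ht⟩
    · left
      rw [position_succ_of_mem SI SII h]
      exact h
    · have hm : position SI SII p ω (k + 1) ∈ moves c ε A (position SI SII p ω k) := by
        rw [position_succ_of_notMem SI SII (disjoint_cylinder_strip h)]
        split_ifs
        · exact SI.legal k _ h
        · exact SII.legal k _ h
      have h1 := snd_le_of_mem_moves hc0 hc1 hA h hm
      rcases moves_subset hε hc0 hc1 hA h hm with h2 | h2
      · refine Or.inr ⟨h2, ?_⟩
        push_cast
        linarith
      · exact Or.inl h2

lemma position_eq_of_le (SI SII : Strategy Ω T c ε A) {p : State N} {ω : ℕ → Bool} {j k : ℕ}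
    (hjk : j ≤ k) (hj : position SI SII p ω j ∈ strip Ω T ε) :
    position SI SII p ω k = position SI SII p ω j := by
  induction k, hjk using Nat.le_induction with
  | base => rfl
  | succ k _ ih => rw [position_succ_of_mem SI SII (ih ▸ hj), ih]

lemma position_hittingRound (SI SII : Strategy Ω T c ε A) {p : State N} {ω : ℕ → Bool} {k : ℕ}
    (hk : position SI SII p ω k ∈ strip Ω T ε) :
    position SI SII p ω (hittingRound SI SII p ω) = position SI SII p ω k :=
  (position_eq_of_le SI SII (Nat.sInf_le hk)
    (Nat.sInf_mem (s := {k | position SI SII p ω k ∈ strip Ω T ε}) ⟨k, hk⟩)).symm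

/-- After a number of rounds that does not depend on the play, the game is over. -/
lemma exists_forall_position_mem_strip (hε : 0 < ε) (hc0 : 0 < c) (hc1 : c < 1)
    (hA : Admissible Ω T c A) :
    ∃ K : ℕ, ∀ (SI SII : Strategy Ω T c ε A),
      ∀ p ∈ cylinder Ω T ∪ strip Ω T ε, ∀ ω, position SI SII p ω K ∈ strip Ω T ε := by
  have hcε : 0 < c * ε ^ 2 := by positivity
  obtain ⟨K, hK⟩ := exists_nat_ge (T / (c * ε ^ 2))
  rw [div_le_iff₀ hcε] at hK
  refine ⟨K, fun SI SII p hp ω => ?_⟩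
  rcases position_mem hε hc0 hc1 hA SI SII hp ω K with h | ⟨h, ht⟩
  · exact h
  · have := h.2.1
    linarith

/-- The token is frozen in the strip, so the random round of hitting can be replaced by the fixed
round `K`. -/
lemma expectedPayoff_eq (SI SII : Strategy Ω T c ε A) {p : State N} {K : ℕ}
    (hK : ∀ ω, position SI SII p ω K ∈ strip Ω T ε) {u : State N → ℝ}
    (hu : ∀ q ∈ strip Ω T ε, u q = F q) :
    expectedPayoff F SI SII p = ∫ ω, u (position SI SII p ω K) ∂coinLaw := by
  refine integral_congr_ae (Filter.Eventually.of_forall fun ω => ?_)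
  simp only
  rw [position_hittingRound SI SII (hK ω), hu _ (hK ω)]

/-- If the mean of `f` over the two moves proposed by the players exceeds the present value by at
most `δ`, then `f` grows in expectation by at most `δ` per round. -/
lemma integral_comp_position_le (hε : 0 < ε) (hc0 : 0 < c) (hc1 : c < 1)
    (hA : Admissible Ω T c A) (SI SII : Strategy Ω T c ε A) {p : State N}
    (hp : p ∈ cylinder Ω T ∪ strip Ω T ε) (f : State N → ℝ) {δ : ℝ} (hδ : 0 ≤ δ)
    (hf : ∀ (k : ℕ) (h : Fin (k + 1) → State N), h (Fin.last k) ∈ cylinder Ω T →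
      f (SI.next k h) + f (SII.next k h) ≤ 2 * (f (h (Fin.last k)) + δ)) (k : ℕ) :
    ∫ ω, f (position SI SII p ω k) ∂coinLaw ≤ f p + k * δ := by
  induction k with
  | zero => simp [position, history]
  | succ k ih =>
    -- Flipping toss `k` keeps the history up to round `k` and exchanges the winners, so the two
    -- next states are the two proposed moves.
    have hstep := integral_le_of_flipToss (k := k) (δ := δ)
      (integrable_comp_position f SI SII p k) (integrable_comp_position f SI SII p (k + 1)) ?_
    · push_cast
      linarith
    · intro ω
      have hflip : position SI SII p (flipToss k ω) k = position SI SII p ω k :=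
        congrFun (history_flipToss SI SII p ω k) _
      rcases position_mem hε hc0 hc1 hA SI SII hp ω k with h | ⟨h, -⟩
      · rw [position_succ_of_mem SI SII h, position_succ_of_mem SI SII (hflip ▸ h), hflip]
        linarith
      · have h' := disjoint_cylinder_strip (ε := ε) h
        have hfk : f (SI.next k (history SI SII p ω k)) + f (SII.next k (history SI SII p ω k)) ≤
          2 * (f (position SI SII p ω k) + δ) := hf k _ h
        rw [position_succ_of_notMem SI SII h', position_succ_of_notMem SI SII (hflip ▸ h'),
          history_flipToss, flipToss_self]
        cases ω k
        · simpa [add_comm] using hfk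
        · simpa using hfk

/-- Memoryless strategies suffice, even against opponents who use the whole history. -/
lemma exists_strategy {P : State N → State N → Prop}
    (hP : ∀ p ∈ cylinder Ω T, ∃ q ∈ moves c ε A p, P p q) :
    ∃ S : Strategy Ω T c ε A, ∀ (k : ℕ) (h : Fin (k + 1) → State N),
      h (Fin.last k) ∈ cylinder Ω T → P (h (Fin.last k)) (S.next k h) := by
  have hP' : ∀ p : State N, ∃ q, p ∈ cylinder Ω T → q ∈ moves c ε A p ∧ P p q := by
    intro p
    by_cases hp : p ∈ cylinder Ω T
    · obtain ⟨q, hq⟩ := hP p hp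
      exact ⟨q, fun _ => hq⟩
    · exact ⟨p, fun h => absurd h hp⟩
  choose g hg using hP'
  exact ⟨⟨fun k h => g (h (Fin.last k)), fun k h hh => (hg _ hh).1⟩, fun k h hh => (hg _ hh).2⟩

/-- A player who always moves almost optimally for a solution `u` of the dynamic programming
principle secures `u p` up to an arbitrarily small error. -/
lemma exists_strategies_near_optimal (hε : 0 < ε) (hc0 : 0 < c) (hc1 : c < 1)
    (hA : Admissible Ω T c A) {u : State N → ℝ} (hu : SatisfiesDPP Ω T c ε A F u)
    {p : State N} (hp : p ∈ cylinder Ω T ∪ strip Ω T ε) {δ : ℝ} (hδ : 0 < δ) :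
    (∃ SI : Strategy Ω T c ε A, ∀ SII, u p - δ ≤ expectedPayoff F SI SII p) ∧
    ∃ SII : Strategy Ω T c ε A, ∀ SI, expectedPayoff F SI SII p ≤ u p + δ := by
  obtain ⟨K, hK⟩ := exists_forall_position_mem_strip hε hc0 hc1 hA
  -- `K + 1` avoids division by zero.
  set d : ℝ := δ / (K + 1) with hd
  have hd0 : 0 < d := by positivity
  have hKd : K * d ≤ δ := by
    have : (K + 1) * d = δ := by rw [hd]; field_simp
    linarith
  constructor
  · obtain ⟨SI, hSI⟩ := exists_strategy (A := A) (T := T) (c := c) (ε := ε)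
      (P := fun p q => ∀ r ∈ moves c ε A p, 2 * u p - d ≤ u q + u r) fun p hp => by
        obtain ⟨a, b, ha, hb, hab⟩ := hu.1 p hp
        obtain ⟨_, ⟨q, hq, rfl⟩, h1, -⟩ := ha.exists_between (sub_lt_self a hd0)
        -- `u q > a - d` and `u r ≥ b`, while `a + b = 2 * u p`.
        exact ⟨q, hq, fun r hr => by linarith [hb.1 (mem_image_of_mem u hr)]⟩
    refine ⟨SI, fun SII => ?_⟩
    have h := integral_comp_position_le hε hc0 hc1 hA SI SII hp (fun q => -u q) hd0.le
      (fun k h hh => by linarith [hSI k h hh _ (SII.legal k h hh)]) K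
    rw [integral_neg] at h
    rw [expectedPayoff_eq SI SII (hK SI SII p hp) hu.2]
    linarith
  · obtain ⟨SII, hSII⟩ := exists_strategy (A := A) (T := T) (c := c) (ε := ε)
      (P := fun p q => ∀ r ∈ moves c ε A p, u r + u q ≤ 2 * u p + d) fun p hp => by
        obtain ⟨a, b, ha, hb, hab⟩ := hu.1 p hp
        obtain ⟨_, ⟨q, hq, rfl⟩, -, h1⟩ := hb.exists_between (lt_add_of_pos_right b hd0)
        exact ⟨q, hq, fun r hr => by linarith [ha.1 (mem_image_of_mem u hr)]⟩
    refine ⟨SII, fun SI => ?_⟩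
    have h := integral_comp_position_le hε hc0 hc1 hA SI SII hp u hd0.le
      (fun k h hh => by linarith [hSII k h hh _ (SI.legal k h hh)]) K
    rw [expectedPayoff_eq SI SII (hK SI SII p hp) hu.2]
    linarith

lemma abs_expectedPayoff_le (hε : 0 < ε) (hc0 : 0 < c) (hc1 : c < 1)
    (hA : Admissible Ω T c A) {M : ℝ} (hF : ∀ q ∈ strip Ω T ε, |F q| ≤ M)
    {p : State N} (hp : p ∈ cylinder Ω T ∪ strip Ω T ε) (SI SII : Strategy Ω T c ε A) :
    |expectedPayoff F SI SII p| ≤ M := by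
  obtain ⟨K, hK⟩ := exists_forall_position_mem_strip hε hc0 hc1 hA
  rw [expectedPayoff_eq SI SII (hK SI SII p hp) (u := F) fun _ _ => rfl]
  have h := norm_integral_le_of_norm_le_const (μ := coinLaw)
    (f := fun ω => F (position SI SII p ω K)) (C := M)
    (Filter.Eventually.of_forall fun ω => hF _ (hK SI SII p hp ω))
  simpa using h

end Game

/-! ### Equality of the two values. -/

/-- The minimax principle: if each side can secure `v` up to any error, both values are `v`. -/
lemma iSup_iInf_eq_and_iInf_iSup_eq {ι κ : Type*} {E : ι → κ → ℝ} {M v : ℝ}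
    (hE : ∀ i j, |E i j| ≤ M) (h1 : ∀ δ > 0, ∃ i, ∀ j, v - δ ≤ E i j)
    (h2 : ∀ δ > 0, ∃ j, ∀ i, E i j ≤ v + δ) :
    ⨆ i, ⨅ j, E i j = v ∧ ⨅ j, ⨆ i, E i j = v := by
  obtain ⟨i₀, -⟩ := h1 1 one_pos
  obtain ⟨j₀, -⟩ := h2 1 one_pos
  have : Nonempty ι := ⟨i₀⟩
  have : Nonempty κ := ⟨j₀⟩
  -- Real `⨆` and `⨅` are meaningful only for bounded families, hence the four bounds.
  have hlow : ∀ i, BddBelow (range fun j => E i j) := fun i =>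
    ⟨-M, by rintro _ ⟨j, rfl⟩; exact (abs_le.1 (hE i j)).1⟩
  have hupp : ∀ j, BddAbove (range fun i => E i j) := fun j =>
    ⟨M, by rintro _ ⟨i, rfl⟩; exact (abs_le.1 (hE i j)).2⟩
  have hlow' : BddBelow (range fun j => ⨆ i, E i j) :=
    ⟨-M, by rintro _ ⟨j, rfl⟩; exact (abs_le.1 (hE i₀ j)).1.trans (le_ciSup (hupp j) i₀)⟩
  have hupp' : BddAbove (range fun i => ⨅ j, E i j) :=
    ⟨M, by rintro _ ⟨i, rfl⟩; exact (ciInf_le (hlow i) j₀).trans (abs_le.1 (hE i j₀)).2⟩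
  refine ⟨le_antisymm (le_of_forall_pos_le_add fun δ hδ => ?_)
    (le_of_forall_pos_sub_le fun δ hδ => ?_), le_antisymm
    (le_of_forall_pos_le_add fun δ hδ => ?_) (le_of_forall_pos_sub_le fun δ hδ => ?_)⟩
  · obtain ⟨j, hj⟩ := h2 δ hδ
    exact ciSup_le fun i => (ciInf_le (hlow i) j).trans (hj i)
  · obtain ⟨i, hi⟩ := h1 δ hδ
    exact (le_ciInf hi).trans (le_ciSup hupp' i)
  · obtain ⟨j, hj⟩ := h2 δ hδ
    exact (ciInf_le hlow' j).trans (ciSup_le hj)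
  · obtain ⟨i, hi⟩ := h1 δ hδ
    exact le_ciInf fun j => (hi j).trans (le_ciSup (hupp j) i)

end TugOfWar

theorem mainTheorem7 {N : ℕ} (Ω : Set (EuclideanSpace ℝ (Fin N))) (hΩ : IsOpen Ω)
    (hΩb : Bornology.IsBounded Ω) (T c η ε : ℝ) (hT : 0 < T) (hc0 : 0 < c) (hc1 : c < 1)
    (hε : 0 < ε) (hεη : ε ≤ η)
    (A : TugOfWar.State N → Set (TugOfWar.State N)) (hA : TugOfWar.Admissible Ω T c A)
    (F : TugOfWar.State N → ℝ)
    (hFm : Measurable fun p : TugOfWar.strip Ω T η => F p)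
    (hFb : ∃ M : ℝ, ∀ p ∈ TugOfWar.strip Ω T η, |F p| ≤ M) :
    ∃ u : TugOfWar.State N → ℝ,
      TugOfWar.SatisfiesDPP Ω T c ε A F u ∧
      (∀ v : TugOfWar.State N → ℝ, TugOfWar.SatisfiesDPP Ω T c ε A F v →
        Set.EqOn v u (TugOfWar.cylinder Ω T ∪ TugOfWar.strip Ω T ε)) ∧
      ∀ p ∈ TugOfWar.cylinder Ω T ∪ TugOfWar.strip Ω T ε,
        TugOfWar.valueI Ω T c ε A F p = u p ∧ TugOfWar.valueII Ω T c ε A F p = u p := by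
  obtain ⟨M, hM⟩ := hFb
  have hF : ∀ p ∈ TugOfWar.strip Ω T ε, |F p| ≤ max M 0 := fun p hp =>
    (hM p (TugOfWar.strip_subset_strip hε hεη hp)).trans (le_max_left _ _)
  obtain ⟨u, hu, -⟩ := TugOfWar.exists_satisfiesDPP hε hc0 hc1 hA (le_max_right M 0) hF
  refine ⟨u, hu, fun v hv => hu.eqOn hε hc0 hc1 hA hv, fun p hp => ?_⟩
  exact TugOfWar.iSup_iInf_eq_and_iInf_iSup_eq
    (TugOfWar.abs_expectedPayoff_le hε hc0 hc1 hA hF hp)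
    (fun δ hδ => (TugOfWar.exists_strategies_near_optimal hε hc0 hc1 hA hu hp hδ).1)
    (fun δ hδ => (TugOfWar.exists_strategies_near_optimal hε hc0 hc1 hA hu hp hδ).2)
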